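/- **Theorem (Karhunen–Loève).** Let $D=[a,b]\subset\mathbb{R}$ with $a<b$, equipped with Lebesgue measure, and let $(\Omega,\mathcal F,P)$ be a probability space. Let $X:D\times\Omega\to\mathbb{R}$ be a stochastic process (each $X_t=X(t,\cdot)$ is a random variable) that is centered, $E[X_t]=0$ for all $t\in D$, mean-square continuous, $\lim_{s\to t,\,s\in D}E[(X_s-X_t)^2]=0$ for all $t\in D$, and satisfies $X\in L^2(D\times\Omega)$. Then $X_t\in L^2(\Omega)$ for every $t\in D$, and, for the autocorrelation integral operator $$[Ku](s)=\int_D R_X(s,t)\,u(t)\,dt,\qquad R_X(s,t)=E[X_sX_t],$$ there exist functions $e_i:D\to\mathbb{R}$ and real numbers $\lambda_i$ ($i=1,2,\dots$) such that $\{e_i\}$ is an orthonormal basis of $L^2(D)$, $[Ke_i](t)=\lambda_i e_i(t)$ for all $i$ and all $t\in D$, and the following holds. For every $i$ the integral $$x_i(\omega)=\int_D X_t(\omega)\,e_i(t)\,dt$$ exists for almost every $\omega$, $x_i\in L^2(\Omega)$, and for all $i,j$ 1. $E[x_i]=0$, 2. $E[x_ix_j]=\delta_{ij}\lambda_j$,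 3. $\operatorname{Var}(x_i)=\lambda_i$. Moreover, for every $t\in D$, $$X_t=\sum_{i=1}^\infty x_i\,e_i(t)\quad\text{in }L^2(\Omega),$$ and the convergence is uniform in $t$: $$\lim_{n\to\infty}\ \sup_{t\in D}\ E\Big[\Big(X_t-\sum_{i=1}^n x_i\,e_i(t)\Big)^2\Big]=0.$$ -/

import Mathlib

open MeasureTheory ProbabilityTheory Filter Topology Set

noncomputable section KarhunenLoeve

variable {Ω : Type*} [MeasurableSpace Ω]

/-- Lebesgue measure on a subset `D` of the real line, as a measure on the type `D`. -/
def lebesgueOn (D : Set ℝ) : Measure D :=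
  Measure.comap (Subtype.val : D → ℝ) volume

/-- A (real valued) stochastic process `X : D × Ω → ℝ`: each `X t` is a random variable. -/
def IsStochasticProcess {D : Set ℝ} (X : D → Ω → ℝ) : Prop :=
  ∀ t, Measurable (X t)

/-- A process is centered if `E[X_t] = 0` for every `t`. -/
def IsCentered {D : Set ℝ} (X : D → Ω → ℝ) (P : Measure Ω) : Prop :=
  ∀ t, Integrable (X t) P ∧ ∫ ω, X t ω ∂P = 0

/-- Mean-square continuity: `E[(X_s - X_t)²] → 0` as `s → t` in `D`, for every `t ∈ D`.
The expectation of the nonnegative variable is taken in `[0, ∞]`, so that an infinite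
second moment is not read as zero. -/
def IsMeanSquareContinuous {D : Set ℝ} (X : D → Ω → ℝ) (P : Measure Ω) : Prop :=
  ∀ t, Tendsto (fun s => ∫⁻ ω, ENNReal.ofReal ((X s ω - X t ω) ^ 2) ∂P) (𝓝 t) (𝓝 0)

/-- The autocorrelation function `R_X(s, t) = E[X_s X_t]`. -/
def autocorr {D : Set ℝ} (X : D → Ω → ℝ) (P : Measure Ω) (s t : D) : ℝ :=
  ∫ ω, X s ω * X t ω ∂P

/-- The autocorrelation integral operator `[K u](s) = ∫_D R_X(s, t) u(t) dt`
(with Lebesgue measure on `D`). -/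
def autocorrOp {D : Set ℝ} (X : D → Ω → ℝ) (P : Measure Ω) (u : D → ℝ) : D → ℝ :=
  fun s => ∫ t, autocorr X P s t * u t ∂(lebesgueOn D)

/-- The coefficient `ω ↦ ∫_D X_t(ω) u(t) dt` of the process along the function `u`. -/
def klCoeff {D : Set ℝ} (X : D → Ω → ℝ) (u : D → ℝ) : Ω → ℝ :=
  fun ω => ∫ t, X t ω * u t ∂(lebesgueOn D)

/-- The functions `e i : D → ℝ` are square integrable and their classes form an orthonormal
(Hilbert) basis of the real Hilbert space `L²(D)`. -/
def IsL2OrthonormalBasis {D : Set ℝ} (e : ℕ → D → ℝ) : Prop :=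
  ∃ he : ∀ i, MemLp (e i) 2 (lebesgueOn D),
    ∃ b : HilbertBasis ℕ ℝ (Lp ℝ 2 (lebesgueOn D)), ∀ i, b i = (he i).toLp (e i)

end KarhunenLoeve

/-! By mean-square continuity the process is a continuous map `v` from the compact interval into H =
L²(Ω). Let S : H → L²(D) send z to s ↦ ⟪v s, z⟫. Its adjoint sends u to the coefficient ∫ X_t u(t)
dt (`klCoeff_ae_eq_adjoint`), and K = S S*. Compactness of the range of `v` makes S compact
(`ContinuousMap.isCompactOperator_innerCLM`), so K has an eigenbasis b_i, and the x_i = S* b_i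
satisfy ⟪x_i, x_j⟫ = ⟪b_i, K b_j⟫ = δ_ij λ_j.

Mercer's theorem is not needed: the n-th partial sum at t is the orthogonal projection of `v t` onto
the span of the first n vectors x_i. These spans exhaust the closed span of the process, so the
errors decrease to zero pointwise, and Dini's theorem makes this uniform
(`exists_karhunenLoeve_expansion`). -/

/-! ### Compact operators and their eigenbases -/

section HilbertSpace

variable {E H : Type*} [NormedAddCommGroup E] [InnerProductSpace ℝ E]
  [NormedAddCommGroup H] [InnerProductSpace ℝ H]

/-- Distinct orthonormal vectors are √2 apart, so the balls of radius 1/2 around them are disjoint.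
-/
theorem Orthonormal.countable_index {ι : Type*} [TopologicalSpace.SeparableSpace E] {v : ι → E}
    (hv : Orthonormal ℝ v) : Countable ι := by
  refine Pairwise.countable_of_isOpen_disjoint (s := fun i => Metric.ball (v i) (1 / 2)) ?_
    (fun _ => Metric.isOpen_ball) (fun i => ⟨v i, Metric.mem_ball_self (by norm_num)⟩)
  intro i j hij
  refine Metric.ball_disjoint_ball ?_
  have h : dist (v i) (v j) ^ 2 = 2 := by
    rw [dist_eq_norm, norm_sub_sq_real, hv.1 i, hv.1 j, hv.2 hij]; norm_num
  nlinarith [dist_nonneg (x := v i) (y := v j)]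

/-- A compact symmetric operator on an infinite-dimensional separable Hilbert space has
a Hilbert basis of eigenvectors indexed by `ℕ`. -/
theorem IsCompactOperator.exists_hilbertBasis_eigenvectors [CompleteSpace E]
    [TopologicalSpace.SeparableSpace E] (hE : ¬ FiniteDimensional ℝ E) {T : E →L[ℝ] E}
    (hT : IsCompactOperator T) (hT' : (T : E →ₗ[ℝ] E).IsSymmetric) :
    ∃ (b : HilbertBasis ℕ ℝ E) (lam : ℕ → ℝ), ∀ i, T (b i) = lam i • b i := by
  -- All real μ are allowed: μ = 0 contributes the kernel, and a non-eigenvalue an empty basis.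
  let G : ℝ → Submodule ℝ E := fun μ => Module.End.eigenspace (T : Module.End ℝ E) μ
  have hcl : ∀ μ, CompleteSpace (G μ) := fun μ => by
    have : IsClosed (G μ : Set E) := by
      have h : (G μ : Set E) = {x | T x = μ • x} := by
        ext x; exact Module.End.mem_eigenspace_iff
      rw [h]
      exact isClosed_eq T.continuous (continuous_const_smul μ)
    exact this.completeSpace_coe
  choose w B hB using fun μ => exists_hilbertBasis ℝ (G μ)
  have hon := hT'.orthogonalFamily_eigenspaces.orthonormal_sigma_orthonormal
    (fun μ => (B μ).orthonormal)
  set f : (Σ μ, w μ) → E := fun a => (B a.1 a.2 : E)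
  have hon : Orthonormal ℝ f := hon
  have hfT : ∀ a, T (f a) = a.1 • f a := fun a =>
    Module.End.mem_eigenspace_iff.1 (B a.1 a.2).2
  have hbot : (Submodule.span ℝ (Set.range f))ᗮ = ⊥ := by
    rw [eq_bot_iff, ← ContinuousLinearMap.orthogonalComplement_iSup_eigenspaces_eq_bot hT hT',
      ← Submodule.iInf_orthogonal]
    intro x hx
    rw [Submodule.mem_iInf]
    intro μ y hy
    have hs := (B μ).hasSum_repr ⟨y, hy⟩
    have h2 := (hs.mapL (G μ).subtypeL).mapL (innerSL ℝ x)
    have h0 : ∀ i, (innerSL ℝ x) ((G μ).subtypeL ((B μ).repr ⟨y, hy⟩ i • (B μ) i)) = 0 := by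
      intro i
      have := hx (f ⟨μ, i⟩) (Submodule.subset_span ⟨_, rfl⟩)
      rw [real_inner_comm] at this
      simp only [map_smul, innerSL_apply_apply, smul_eq_mul, Submodule.subtypeL_apply]
      rw [show inner ℝ x ((B μ i : G μ) : E) = 0 from this, mul_zero]
    simp only [h0] at h2
    have := h2.unique hasSum_zero
    rw [real_inner_comm]
    simpa using this
  have hcount : Countable (Σ μ, w μ) := hon.countable_index
  have hinf : Infinite (Σ μ, w μ) := by
    by_contra hfin
    rw [not_infinite_iff_finite] at hfin
    have : FiniteDimensional ℝ (Submodule.span ℝ (Set.range f)) :=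
      FiniteDimensional.span_of_finite ℝ (Set.finite_range f)
    rw [Submodule.orthogonal_eq_bot_iff] at hbot
    rw [hbot] at this
    exact hE (Submodule.topEquiv.finiteDimensional)
  obtain ⟨e⟩ : Nonempty (ℕ ≃ Σ μ, w μ) := by
    have := Encodable.ofCountable (Σ μ, w μ)
    have := Denumerable.ofEncodableOfInfinite (Σ μ, w μ)
    exact ⟨(Denumerable.eqv _).symm⟩
  refine ⟨HilbertBasis.mkOfOrthogonalEqBot (hon.comp e e.injective) ?_, fun i => (e i).1, ?_⟩
  · rw [Set.range_comp, e.surjective.range_eq, Set.image_univ]; exact hbot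
  · intro i
    rw [HilbertBasis.coe_mkOfOrthogonalEqBot]
    exact hfT _

theorem isCompactOperator_of_forall_exists_norm_sub_lt {F G : Type*} [NormedAddCommGroup F]
    [NormedSpace ℝ F] [NormedAddCommGroup G] [NormedSpace ℝ G] [CompleteSpace G] (T : F →L[ℝ] G)
    (h : ∀ ε > 0, ∃ S : F →L[ℝ] G, IsCompactOperator S ∧ ‖T - S‖ < ε) : IsCompactOperator T :=
  isClosed_setOfPred_isCompactOperator.closure_subset
    (SeminormedAddCommGroup.mem_closure_iff.2 h)

variable {D : Type*} [TopologicalSpace D] [CompactSpace D]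

/-- The operator `z ↦ (s ↦ ⟪v s, z⟫)` associated with a continuous map `v` into a Hilbert space. -/
noncomputable def ContinuousMap.innerCLM (v : C(D, H)) : H →L[ℝ] C(D, ℝ) :=
  LinearMap.mkContinuous
    { toFun := fun z => ⟨fun s => inner ℝ (v s) z, by fun_prop⟩
      map_add' := fun x y => by ext s; simp [inner_add_right]
      map_smul' := fun c x => by ext s; simp [inner_smul_right] } ‖v‖ (fun z => by
    rw [ContinuousMap.norm_le _ (by positivity)]
    intro s
    exact (norm_inner_le_norm _ _).trans (by gcongr; exact v.norm_coe_le_norm s))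

@[simp]
theorem ContinuousMap.innerCLM_apply (v : C(D, H)) (z : H) (s : D) :
    v.innerCLM z s = inner ℝ (v s) z := rfl

/-- Project onto the span of a finite ε/2-net of the range of `v`. The residual of z is orthogonal
to the net, so `v s` may be replaced by its difference from a nearby net point when paired with it.
-/
theorem ContinuousMap.isCompactOperator_innerCLM [CompleteSpace H] (v : C(D, H)) :
    IsCompactOperator v.innerCLM := by
  refine isCompactOperator_of_forall_exists_norm_sub_lt _ fun ε hε => ?_
  have htb : TotallyBounded (Set.range v) := (isCompact_range v.continuous).totallyBounded
  obtain ⟨t, ht, hcov⟩ := Metric.totallyBounded_iff.1 htb (ε / 2) (by positivity)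
  have : FiniteDimensional ℝ (Submodule.span ℝ t) := FiniteDimensional.span_of_finite ℝ ht
  set V := Submodule.span ℝ t
  refine ⟨v.innerCLM ∘L V.starProjection, ?_, ?_⟩
  · have h1 : IsCompactOperator V.orthogonalProjectionOnto :=
      isCompactOperator_of_locallyCompactSpace_dom V.orthogonalProjectionOnto
    exact h1.clm_comp (v.innerCLM ∘L V.subtypeL)
  · refine lt_of_le_of_lt (ContinuousLinearMap.opNorm_le_bound _ (by positivity) ?_)
      (half_lt_self hε)
    intro z
    rw [ContinuousMap.norm_le _ (by positivity)]
    intro s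
    obtain ⟨y, hy, hys⟩ : ∃ y ∈ t, v s ∈ Metric.ball y (ε / 2) := by
      simpa using hcov ⟨s, rfl⟩
    have hyV : y ∈ V := Submodule.subset_span hy
    have h0 : inner ℝ y (z - V.starProjection z) = 0 :=
      (V.sub_starProjection_mem_orthogonal z) y hyV
    have h1 : (v.innerCLM - v.innerCLM ∘L V.starProjection) z s
        = inner ℝ (v s - y) (z - V.starProjection z) := by
      rw [inner_sub_left, h0, inner_sub_right]; simp
    rw [h1]
    refine (norm_inner_le_norm _ _).trans ?_
    have h2 : ‖z - V.starProjection z‖ ≤ ‖z‖ := by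
      have := V.norm_sq_eq_add_norm_sq_starProjection z
      rw [Submodule.starProjection_orthogonal_val] at this
      refine le_of_sq_le_sq ?_ (norm_nonneg _)
      nlinarith [sq_nonneg ‖V.starProjection z‖]
    rw [Metric.mem_ball, dist_eq_norm] at hys
    gcongr

end HilbertSpace

/-! ### The expansion of a continuous Hilbert-space-valued map -/

section Expansion

variable {D H : Type*} [TopologicalSpace D] [CompactSpace D] [MeasurableSpace D] [BorelSpace D]
  [NormedAddCommGroup H] [InnerProductSpace ℝ H]

/-- The operator `H → L²(D)` sending `z` to the class of `s ↦ ⟪v s, z⟫`. -/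
noncomputable def ContinuousMap.innerLp (v : C(D, H)) (μ : Measure D) [IsFiniteMeasure μ] :
    H →L[ℝ] Lp ℝ 2 μ :=
  ContinuousMap.toLp 2 μ ℝ ∘L v.innerCLM

variable (v : C(D, H)) (μ : Measure D) [IsFiniteMeasure μ]

theorem ContinuousMap.coeFn_innerLp (z : H) :
    v.innerLp μ z =ᵐ[μ] fun s => inner ℝ (v s) z :=
  ContinuousMap.coeFn_toLp μ (v.innerCLM z)

theorem ContinuousMap.innerLp_inner (z : H) (u : Lp ℝ 2 μ) :
    inner ℝ (v.innerLp μ z) u = ∫ t, inner ℝ (v t) z * u t ∂μ := by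
  rw [L2.inner_def]
  refine integral_congr_ae ?_
  filter_upwards [v.coeFn_innerLp μ z] with t ht
  rw [ht]
  simp [mul_comm]

/-- A continuous function vanishing almost everywhere vanishes everywhere when the measure has full
support. -/
theorem ContinuousMap.innerLp_eq_zero [μ.IsOpenPosMeasure] {z : H} (hz : v.innerLp μ z = 0)
    (t : D) : inner ℝ (v t) z = 0 := by
  have h : v.innerCLM z = 0 :=
    ContinuousMap.toLp_injective (p := 2) (𝕜 := ℝ) μ (hz.trans (map_zero _).symm)
  exact DFunLike.congr_fun h t

theorem exists_karhunenLoeve_expansion [CompleteSpace H] [μ.IsOpenPosMeasure]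
    [TopologicalSpace.SeparableSpace (Lp ℝ 2 μ)] (hE : ¬ FiniteDimensional ℝ (Lp ℝ 2 μ)) :
    ∃ (b : HilbertBasis ℕ ℝ (Lp ℝ 2 μ)) (e : ℕ → D → ℝ) (lam : ℕ → ℝ),
      (∀ i, b i =ᵐ[μ] e i) ∧
      (∀ i t, inner ℝ (v t) ((v.innerLp μ).adjoint (b i)) = lam i * e i t) ∧
      (∀ i j, inner ℝ ((v.innerLp μ).adjoint (b i)) ((v.innerLp μ).adjoint (b j))
        = if i = j then lam j else 0) ∧
      TendstoUniformly (fun (n : ℕ) (t : D) =>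
        ‖v t - ∑ i ∈ Finset.range n, e i t • (v.innerLp μ).adjoint (b i)‖ ^ 2)
        (fun _ => 0) atTop := by
  set S := v.innerLp μ with hS
  have hScomp : IsCompactOperator S :=
    v.isCompactOperator_innerCLM.clm_comp (ContinuousMap.toLp 2 μ ℝ)
  have hT : IsCompactOperator (S ∘L S.adjoint) := hScomp.comp_clm S.adjoint
  have hT' : (S ∘L S.adjoint).toLinearMap.IsSymmetric := by
    intro x y
    change inner ℝ (S (S.adjoint x)) y = inner ℝ x (S (S.adjoint y))
    rw [← ContinuousLinearMap.adjoint_inner_right, ContinuousLinearMap.adjoint_inner_left]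
  obtain ⟨b, lam, hb⟩ := hT.exists_hilbertBasis_eigenvectors hE hT'
  set x : ℕ → H := fun i => S.adjoint (b i) with hx
  have hb : ∀ i, S (x i) = lam i • b i := hb
  have horth : ∀ i j, inner ℝ (x i) (x j) = if i = j then lam j else 0 := by
    intro i j
    rw [hx]
    dsimp only
    rw [ContinuousLinearMap.adjoint_inner_left, show S (S.adjoint (b j)) = lam j • b j from hb j,
      inner_smul_right, orthonormal_iff_ite.1 b.orthonormal i j]
    simp
  have hx0 : ∀ i, lam i = 0 → x i = 0 := by
    intro i hi
    rw [← inner_self_eq_zero (𝕜 := ℝ), horth, if_pos rfl, hi]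
  -- For λ_i ≠ 0 this is the continuous representative, for which the eigenvalue equation holds at
  -- every t. For λ_i = 0 any representative works, since x_i = 0.
  set e : ℕ → D → ℝ := fun i t => if lam i = 0 then b i t else (lam i)⁻¹ * inner ℝ (v t) (x i)
    with he
  have he_ae : ∀ i, b i =ᵐ[μ] e i := by
    intro i
    by_cases hi : lam i = 0
    · simp only [he, if_pos hi]; rfl
    · simp only [he, if_neg hi]
      filter_upwards [v.coeFn_innerLp μ (x i), Lp.coeFn_smul (lam i) (b i)] with t h1 h2
      rw [← hS, hb i, h2] at h1
      rw [← h1]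
      simp [hi]
  have heig : ∀ i t, inner ℝ (v t) (x i) = lam i * e i t := by
    intro i t
    by_cases hi : lam i = 0
    · rw [hx0 i hi, hi]; simp
    · simp only [he, if_neg hi]; field_simp
  have hsmul : ∀ i t, e i t • x i = (lam i)⁻¹ • inner ℝ (v t) (x i) • x i := by
    intro i t
    by_cases hi : lam i = 0
    · rw [hx0 i hi]; simp
    · rw [heig, smul_smul]; field_simp
  let W : ℕ → Submodule ℝ H := fun n => Submodule.span ℝ (x '' (Finset.range n : Set ℕ))
  have hWfin : ∀ n, FiniteDimensional ℝ (W n) := fun n =>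
    FiniteDimensional.span_of_finite ℝ ((Finset.finite_toSet _).image _)
  have hWmono : Monotone W := fun m n hmn =>
    Submodule.span_mono (Set.image_mono (by simpa using hmn))
  -- Both `v t` and the partial sum have inner product λ_j e_j(t) with x_j for j < n.
  have hproj : ∀ n t, ∑ i ∈ Finset.range n, e i t • x i = (W n).starProjection (v t) := by
    intro n t
    refine (Submodule.eq_starProjection_of_mem_of_inner_eq_zero ?_ ?_).symm
    · exact Submodule.sum_mem _ fun i hi =>
        Submodule.smul_mem _ _ (Submodule.subset_span ⟨i, hi, rfl⟩)
    · intro w hw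
      induction hw using Submodule.span_induction with
      | mem w hw =>
        obtain ⟨j, hj, rfl⟩ := hw
        rw [inner_sub_left, sum_inner, heig]
        simp only [inner_smul_left, horth]
        simp [Finset.mem_range.1 hj, mul_comm]
      | zero => simp
      | add w z _ _ h1 h2 => rw [inner_add_right, h1, h2, add_zero]
      | smul c w _ h => rw [inner_smul_right, h, mul_zero]
  -- If z is orthogonal to every x_i = S* b_i, then S z is orthogonal to the basis, so S z = 0 and z
  -- is orthogonal to every `v t`.
  have hclosure : ∀ t, v t ∈ (⨆ n, W n).topologicalClosure := by
    intro t
    rw [← Submodule.orthogonal_orthogonal_eq_closure]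
    intro z hz
    have hz0 : ∀ i, inner ℝ (x i) z = 0 := fun i =>
      hz (x i) (Submodule.mem_iSup_of_mem (i + 1)
        (Submodule.subset_span ⟨i, by simp, rfl⟩))
    have hSz : S z = 0 := by
      refine b.repr.injective ?_
      ext i
      rw [b.repr_apply_apply, ← ContinuousLinearMap.adjoint_inner_left]
      simpa using hz0 i
    rw [real_inner_comm]
    exact v.innerLp_eq_zero μ hSz t
  refine ⟨b, e, lam, he_ae, heig, horth, ?_⟩
  have hform : ∀ n t, ‖v t - ∑ i ∈ Finset.range n, e i t • S.adjoint (b i)‖ ^ 2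
      = ‖v t‖ ^ 2 - ‖(W n).starProjection (v t)‖ ^ 2 := by
    intro n t
    rw [show ∑ i ∈ Finset.range n, e i t • S.adjoint (b i) = _ from hproj n t]
    have := (W n).norm_sq_eq_add_norm_sq_starProjection (v t)
    rw [Submodule.starProjection_orthogonal_val] at this
    linarith
  simp only [hform]
  -- Dini's theorem: the errors are continuous in t and decrease with n, as the subspaces grow.
  refine Antitone.tendstoUniformly_of_forall_tendsto ?_ ?_ continuous_const ?_
  · intro n
    fun_prop
  · intro m n hmn t
    have : (W m).starProjection (v t) = (W m).starProjection ((W n).starProjection (v t)) := by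
      rw [Submodule.starProjection_apply, Submodule.starProjection_apply (W m),
        Submodule.orthogonalProjectionOnto_starProjection_of_le (hWmono hmn)]
    have h2 : ‖(W m).starProjection (v t)‖ ≤ ‖(W n).starProjection (v t)‖ := by
      rw [this]; exact Submodule.norm_starProjection_apply_le _ _
    dsimp only
    gcongr
  · intro t
    have h := Submodule.starProjection_tendsto_closure_iSup W hWmono (v t)
    rw [Submodule.starProjection_eq_self_iff.2 (hclosure t)] at h
    have := (tendsto_const_nhds (x := ‖v t‖ ^ 2)).sub (h.norm.pow 2)
    simpa using this

end Expansion

/-! ### Lebesgue measure on a compact interval -/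

section Lebesgue

instance isFiniteMeasure_lebesgueOn_Icc (a b : ℝ) : IsFiniteMeasure (lebesgueOn (Icc a b)) := by
  constructor
  rw [lebesgueOn, comap_subtype_coe_apply measurableSet_Icc]
  exact (measure_mono (t := Icc a b) (by rintro _ ⟨x, _, rfl⟩; exact x.2)).trans_lt
    measure_Icc_lt_top

theorem isOpenPosMeasure_lebesgueOn_Icc {a b : ℝ} (hab : a < b) :
    (lebesgueOn (Icc a b)).IsOpenPosMeasure := by
  constructor
  rintro U hU ⟨x, hx⟩
  obtain ⟨V, hV, rfl⟩ := isOpen_induced_iff.1 hU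
  rw [lebesgueOn, comap_subtype_coe_apply measurableSet_Icc, Subtype.image_preimage_coe]
  have hx' : (x : ℝ) ∈ closure (Ioo a b) := by rw [closure_Ioo hab.ne]; exact x.2
  have hne : (V ∩ Ioo a b).Nonempty := mem_closure_iff.1 hx' V hV hx
  have hpos := (hV.inter isOpen_Ioo).measure_pos volume hne
  refine (hpos.trans_le (measure_mono ?_)).ne'
  rw [Set.inter_comm]
  exact Set.inter_subset_inter_left _ Ioo_subset_Icc_self

/-- Polynomials embed into L²: they are determined by their values on an infinite set. -/
theorem not_finiteDimensional_L2_lebesgueOn_Icc {a b : ℝ} (hab : a < b) :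
    ¬ FiniteDimensional ℝ (Lp ℝ 2 (lebesgueOn (Icc a b))) := by
  intro h
  have := isOpenPosMeasure_lebesgueOn_Icc hab
  let φ : Polynomial ℝ →ₗ[ℝ] Lp ℝ 2 (lebesgueOn (Icc a b)) :=
    (ContinuousMap.toLp (E := ℝ) 2 (lebesgueOn (Icc a b)) ℝ).toLinearMap ∘ₗ
      (Polynomial.toContinuousMapOnAlgHom (Icc a b)).toLinearMap
  have hφ : Function.Injective φ := by
    refine (ContinuousMap.toLp_injective (p := 2) (𝕜 := ℝ) _).comp ?_
    intro p q hpq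
    refine Polynomial.eq_of_infinite_eval_eq p q ((Icc_infinite hab).mono fun x hx => ?_)
    exact DFunLike.congr_fun hpq (⟨x, hx⟩ : Icc a b)
  have := FiniteDimensional.of_injective φ hφ
  exact Polynomial.not_finite this

end Lebesgue

/-! ### Second-order processes as maps into L²(Ω) -/

section SecondOrder

variable {Ω : Type*} [MeasurableSpace Ω]

theorem eLpNorm_two_eq_lintegral_ofReal_sq (f : Ω → ℝ) (P : Measure Ω) :
    eLpNorm f 2 P = (∫⁻ ω, ENNReal.ofReal (f ω ^ 2) ∂P) ^ (1 / 2 : ℝ) := by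
  rw [eLpNorm_eq_lintegral_rpow_enorm_toReal (by simp) (by simp)]
  simp only [ENNReal.toReal_ofNat]
  congr 2
  ext ω
  rw [← sq_abs, ENNReal.ofReal_pow (abs_nonneg _), ← Real.enorm_eq_ofReal_abs]
  norm_cast

variable {D : Set ℝ} {X : D → Ω → ℝ} {P : Measure Ω}

theorem IsMeanSquareContinuous.tendsto_eLpNorm (hcont : IsMeanSquareContinuous X P) (t : D) :
    Tendsto (fun s => eLpNorm (X s - X t) 2 P) (𝓝 t) (𝓝 0) := by
  simp only [eLpNorm_two_eq_lintegral_ofReal_sq]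
  have := (ENNReal.continuous_rpow_const (y := 1 / 2)).continuousAt.tendsto.comp (hcont t)
  simpa [Function.comp_def] using this

/-- By Fubini almost every X_s is in L²(Ω). Such s are dense, so one lies close enough to t for X_s
- X_t to have finite norm. -/
theorem IsMeanSquareContinuous.memLp [IsFiniteMeasure P] [IsFiniteMeasure (lebesgueOn D)]
    [(lebesgueOn D).IsOpenPosMeasure] (hX : IsStochasticProcess X)
    (hcont : IsMeanSquareContinuous X P)
    (hL2 : MemLp (fun p : D × Ω => X p.1 p.2) 2 ((lebesgueOn D).prod P)) (t : D) :
    MemLp (X t) 2 P := by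
  have hae : ∀ᵐ s ∂(lebesgueOn D), MemLp (X s) 2 P := by
    filter_upwards [hL2.integrable_sq.prod_right_ae] with s hs
    exact (memLp_two_iff_integrable_sq (hX s).aestronglyMeasurable).2 hs
  have hev : ∀ᶠ s in 𝓝 t, eLpNorm (X s - X t) 2 P < ⊤ :=
    (hcont.tendsto_eLpNorm t).eventually (gt_mem_nhds ENNReal.zero_lt_top)
  obtain ⟨s, hs, hst⟩ := ((Measure.dense_of_ae hae).inter_nhds_nonempty hev)
  have hsub : MemLp (X s - X t) 2 P := ⟨((hX s).sub (hX t)).aestronglyMeasurable, hst⟩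
  have := hs.sub hsub
  simpa using this

/-- A mean-square continuous process as a continuous map into `L²(Ω)`. -/
noncomputable def IsMeanSquareContinuous.toContinuousMap (hcont : IsMeanSquareContinuous X P)
    (hX2 : ∀ t, MemLp (X t) 2 P) : C(D, Lp ℝ 2 P) where
  toFun t := (hX2 t).toLp (X t)
  continuous_toFun := by
    refine continuous_iff_continuousAt.2 fun t => ?_
    rw [ContinuousAt, tendsto_iff_edist_tendsto_0]
    simp only [Lp.edist_toLp_toLp]
    exact hcont.tendsto_eLpNorm t

theorem IsMeanSquareContinuous.toContinuousMap_apply (hcont : IsMeanSquareContinuous X P)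
    (hX2 : ∀ t, MemLp (X t) 2 P) (t : D) :
    hcont.toContinuousMap hX2 t = (hX2 t).toLp (X t) := rfl

theorem integrable_process_mul [IsFiniteMeasure P] [IsFiniteMeasure (lebesgueOn D)]
    (hL2 : MemLp (fun p : D × Ω => X p.1 p.2) 2 ((lebesgueOn D).prod P))
    {u : D → ℝ} (hu : MemLp u 2 (lebesgueOn D)) :
    Integrable (fun p : D × Ω => X p.1 p.2 * u p.1) ((lebesgueOn D).prod P) :=
  hL2.integrable_mul (hu.comp_fst P)

/-- The coefficient of the process along `u` is the value at `u` of the adjoint of the operator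
`L²(Ω) → L²(D)` defined by the process. -/
theorem klCoeff_ae_eq_adjoint [CompactSpace D] [IsFiniteMeasure P]
    [IsFiniteMeasure (lebesgueOn D)] (hcont : IsMeanSquareContinuous X P)
    (hX2 : ∀ t, MemLp (X t) 2 P)
    (hL2 : MemLp (fun p : D × Ω => X p.1 p.2) 2 ((lebesgueOn D).prod P))
    {u : D → ℝ} (w : Lp ℝ 2 (lebesgueOn D)) (huw : w =ᵐ[lebesgueOn D] u) :
    klCoeff X u =ᵐ[P]
      ((hcont.toContinuousMap hX2).innerLp (lebesgueOn D)).adjoint w := by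
  have hint := integrable_process_mul hL2 ((memLp_congr_ae huw).1 (Lp.memLp w))
  -- Integrate both sides over each measurable A: the adjoint moves to the indicator of A, and
  -- Fubini does the rest.
  refine Integrable.ae_eq_of_forall_setIntegral_eq _ _ hint.integral_prod_right
    ((Lp.memLp _).integrable (by norm_num)) fun A hA hPA => ?_
  rw [← L2.inner_indicatorConstLp_one (𝕜 := ℝ) hA hPA.ne,
    ContinuousLinearMap.adjoint_inner_right, ContinuousMap.innerLp_inner]
  have hintA : Integrable (fun p : D × Ω => X p.1 p.2 * u p.1)
      ((lebesgueOn D).prod (P.restrict A)) :=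
    hint.mono_measure (Measure.prod_mono le_rfl Measure.restrict_le_self)
  have hswap : ∫ ω in A, klCoeff X u ω ∂P
      = ∫ t, ∫ ω in A, X t ω * u t ∂P ∂(lebesgueOn D) :=
    (integral_integral_swap hintA).symm
  rw [hswap]
  refine integral_congr_ae ?_
  filter_upwards [huw] with t ht
  rw [integral_mul_const, ht, real_inner_comm, L2.inner_indicatorConstLp_one]
  congr 1
  exact integral_congr_ae (ae_restrict_of_ae (hX2 t).coeFn_toLp.symm)

theorem autocorr_eq_inner (hcont : IsMeanSquareContinuous X P)
    (hX2 : ∀ t, MemLp (X t) 2 P) (s t : D) :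
    autocorr X P s t
      = inner ℝ (hcont.toContinuousMap hX2 s) (hcont.toContinuousMap hX2 t) := by
  rw [L2.inner_def]
  refine integral_congr_ae ?_
  filter_upwards [(hX2 s).coeFn_toLp, (hX2 t).coeFn_toLp] with ω h1 h2
  rw [hcont.toContinuousMap_apply, hcont.toContinuousMap_apply, h1, h2]
  simp [mul_comm]

theorem autocorrOp_eq_inner_adjoint [CompactSpace D] [IsFiniteMeasure (lebesgueOn D)]
    (hcont : IsMeanSquareContinuous X P) (hX2 : ∀ t, MemLp (X t) 2 P)
    {u : D → ℝ} (w : Lp ℝ 2 (lebesgueOn D)) (huw : w =ᵐ[lebesgueOn D] u) (s : D) :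
    autocorrOp X P u s = inner ℝ (hcont.toContinuousMap hX2 s)
      (((hcont.toContinuousMap hX2).innerLp (lebesgueOn D)).adjoint w) := by
  rw [ContinuousLinearMap.adjoint_inner_right, ContinuousMap.innerLp_inner]
  refine integral_congr_ae ?_
  filter_upwards [huw] with t ht
  rw [autocorr_eq_inner hcont hX2, ht, real_inner_comm]

end SecondOrder

/-! ### The Karhunen–Loève theorem -/

theorem mainTheorem1 {Ω : Type*} [MeasurableSpace Ω] (P : Measure Ω) [IsProbabilityMeasure P]
    (a b : ℝ) (hab : a < b) (X : Icc a b → Ω → ℝ)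
    (hX : IsStochasticProcess X)
    (hcent : IsCentered X P)
    (hcont : IsMeanSquareContinuous X P)
    (hL2 : MemLp (fun p : Icc a b × Ω => X p.1 p.2) 2
      ((lebesgueOn (Icc a b)).prod P)) :
    ∃ (e : ℕ → Icc a b → ℝ) (lam : ℕ → ℝ),
      -- an orthonormal basis of `L²(D)` made of eigenfunctions of the operator `K`
      IsL2OrthonormalBasis e ∧
      (∀ i t, autocorrOp X P (e i) t = lam i * e i t) ∧
      -- the coefficients are well-defined square integrable random variables
      (∀ i, ∀ᵐ ω ∂P, Integrable (fun t : Icc a b => X t ω * e i t) (lebesgueOn (Icc a b))) ∧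
      (∀ i, MemLp (klCoeff X (e i)) 2 P) ∧
      (∀ i, ∫ ω, klCoeff X (e i) ω ∂P = 0) ∧
      (∀ i j, ∫ ω, klCoeff X (e i) ω * klCoeff X (e j) ω ∂P = if i = j then lam j else 0) ∧
      (∀ i, variance (klCoeff X (e i)) P = lam i) ∧
      -- for every `t`, the expansion of `X t` converges in `L²(Ω)`
      (∀ t, MemLp (X t) 2 P) ∧
      (∀ t, Tendsto (fun n => eLpNorm
        (fun ω => X t ω - ∑ i ∈ Finset.range n, klCoeff X (e i) ω * e i t) 2 P) atTop (𝓝 0)) ∧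
      -- the mean-square error tends to zero uniformly in `t`
      TendstoUniformly (fun (n : ℕ) (t : Icc a b) =>
        ∫ ω, (X t ω - ∑ i ∈ Finset.range n, klCoeff X (e i) ω * e i t) ^ 2 ∂P)
        (fun _ => 0) atTop := by
  have := isOpenPosMeasure_lebesgueOn_Icc hab
  have : Fact ((2 : ENNReal) ≠ ⊤) := ⟨by simp⟩
  have hX2 : ∀ t, MemLp (X t) 2 P := hcont.memLp hX hL2
  set v := hcont.toContinuousMap hX2 with hv
  obtain ⟨B, e, lam, hBe, heig, horth, hunif⟩ := exists_karhunenLoeve_expansion v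
    (lebesgueOn (Icc a b)) (not_finiteDimensional_L2_lebesgueOn_Icc hab)
  set x := fun i => (v.innerLp (lebesgueOn (Icc a b))).adjoint (B i)
  have he2 : ∀ i, MemLp (e i) 2 (lebesgueOn (Icc a b)) := fun i =>
    (memLp_congr_ae (hBe i)).1 (Lp.memLp _)
  have hkl : ∀ i, klCoeff X (e i) =ᵐ[P] x i := fun i =>
    klCoeff_ae_eq_adjoint hcont hX2 hL2 (B i) (hBe i)
  have hK : ∀ i t, autocorrOp X P (e i) t = lam i * e i t := fun i t =>
    (autocorrOp_eq_inner_adjoint hcont hX2 (B i) (hBe i) t).trans (heig i t)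
  replace horth : ∀ i j, inner ℝ (x i) (x j) = if i = j then lam j else 0 := horth
  replace hunif : TendstoUniformly (fun (n : ℕ) (t : Icc a b) =>
      ‖v t - ∑ i ∈ Finset.range n, e i t • x i‖ ^ 2) (fun _ => 0) atTop := hunif
  clear_value x
  have hkl2 : ∀ i, MemLp (klCoeff X (e i)) 2 P := fun i =>
    (memLp_congr_ae (hkl i)).2 (Lp.memLp _)
  have hmean : ∀ i, ∫ ω, klCoeff X (e i) ω ∂P = 0 := by
    intro i
    have hint := integrable_process_mul hL2 (he2 i)
    have hswap : ∫ ω, klCoeff X (e i) ω ∂P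
        = ∫ t, ∫ ω, X t ω * e i t ∂P ∂(lebesgueOn (Icc a b)) :=
      (integral_integral_swap hint).symm
    rw [hswap]
    simp [integral_mul_const, (hcent _).2]
  have hcov : ∀ i j, ∫ ω, klCoeff X (e i) ω * klCoeff X (e j) ω ∂P
      = if i = j then lam j else 0 := by
    intro i j
    rw [← horth i j, L2.inner_def]
    refine integral_congr_ae ?_
    filter_upwards [hkl i, hkl j] with ω h1 h2
    rw [h1, h2]
    simp only [RCLike.inner_apply, conj_trivial, mul_comm]
  have hmem : ∀ n t, MemLp
      (fun ω => X t ω - ∑ i ∈ Finset.range n, klCoeff X (e i) ω * e i t) 2 P := fun n t =>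
    (hX2 t).sub (memLp_finsetSum _ fun i _ => (hkl2 i).mul_const (e i t))
  have htoLp : ∀ n t, (hmem n t).toLp _ = v t - ∑ i ∈ Finset.range n, e i t • x i := by
    intro n t
    have hxi : ∀ i, x i = (hkl2 i).toLp _ := fun i =>
      Lp.ext ((hkl i).symm.trans (hkl2 i).coeFn_toLp.symm)
    refine Lp.ext ((hmem n t).coeFn_toLp.trans ?_)
    refine EventuallyEq.symm ((Lp.coeFn_sub _ _).trans ?_)
    have hsum := Lp.coeFn_finsetSum (Finset.range n) fun i => e i t • x i
    have hall : ∀ᵐ ω ∂P, ∀ i, (e i t • x i : Lp ℝ 2 P) ω = klCoeff X (e i) ω * e i t := by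
      refine ae_all_iff.2 fun i => ?_
      filter_upwards [Lp.coeFn_smul (e i t) (x i), hkl i] with ω h1 h2
      rw [h1, h2]
      simp [mul_comm]
    filter_upwards [hsum, hall, (hX2 t).coeFn_toLp] with ω h1 h2 h3
    rw [Pi.sub_apply, h1, hv, hcont.toContinuousMap_apply, h3, Finset.sum_apply]
    simp only [h2]
  have hunif' : TendstoUniformly (fun (n : ℕ) (t : Icc a b) =>
      ∫ ω, (X t ω - ∑ i ∈ Finset.range n, klCoeff X (e i) ω * e i t) ^ 2 ∂P)
      (fun _ => 0) atTop := by
    have hfun : ∀ n t, ∫ ω, (X t ω - ∑ i ∈ Finset.range n, klCoeff X (e i) ω * e i t) ^ 2 ∂P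
        = ‖v t - ∑ i ∈ Finset.range n, e i t • x i‖ ^ 2 := by
      intro n t
      rw [← htoLp, ← real_inner_self_eq_norm_sq, L2.inner_def]
      refine integral_congr_ae ?_
      filter_upwards [(hmem n t).coeFn_toLp] with ω h
      rw [h]
      simp [sq]
    simp only [hfun]
    exact hunif
  refine ⟨e, lam, ⟨he2, B, fun i => Lp.ext ((hBe i).trans (he2 i).coeFn_toLp.symm)⟩,
    hK, fun i => (integrable_process_mul hL2 (he2 i)).prod_left_ae, hkl2, hmean, hcov, ?_, hX2,
    ?_, hunif'⟩
  · intro i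
    rw [variance_of_integral_eq_zero (hkl2 i).aestronglyMeasurable.aemeasurable (hmean i)]
    simpa [sq] using hcov i i
  · intro t
    have h := hunif.tendsto_at t
    have h' : Tendsto (fun n => ‖v t - ∑ i ∈ Finset.range n, e i t • x i‖) atTop (𝓝 0) := by
      simpa using h.sqrt
    have h'' := ENNReal.tendsto_ofReal h'
    simp only [ENNReal.ofReal_zero] at h''
    refine h''.congr fun n => ?_
    rw [← htoLp, Lp.norm_toLp, ENNReal.ofReal_toReal (hmem n t).2.ne]
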